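/- Let $K$ be a field and let $H$ be a finite simple bipartite graph with vertex set $V(H)$. Let $R=K[x_v : v\in V(H)]$ with its standard grading, and let $I(H)=(x_ux_v : \{u,v\}\in E(H))\subseteq R$ be the edge ideal of $H$. For $i,j\ge 0$, let $\beta_{i,j}(R/I(H))$ be the number of summands $R(-j)$ in homological degree $i$ of a minimal graded free resolution of $R/I(H)$ over $R$ (such a resolution exists, and this number is the same for all of them). Then for every integer $i\ge 0$, $$\beta_{i,i+1}(R/I(H))=\#\{\mathcal S\subseteq V(H) : |\mathcal S|=i+1,\ H^c_{\mathcal S}\text{ has exactly two connected components}\},$$ where $H^c_{\mathcal S}$ denotes the subgraph induced on $\mathcal S$ by the complement graph $H^c$ of $H$. -/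

import Mathlib

open MvPolynomial

/-- The edge ideal `I(H) = (x_u x_v : {u, v} ∈ E(H))` in `K[x_v : v ∈ V]`. -/
noncomputable def edgeIdeal (K : Type*) [Field K] {V : Type*} (H : SimpleGraph V) :
    Ideal (MvPolynomial V K) :=
  Ideal.span {p | ∃ u v : V, H.Adj u v ∧ p = X u * X v}

/-- An element `v` of the graded free module `⨁_b R(-deg b)`, where `R = K[x_v : v ∈ V]` is
standard graded, is homogeneous of degree `n`: its `b`-th coordinate is a `K`-linear combination of
monomials of degree `n - deg b` (so it is zero if `n < deg b`). -/
def IsHomogeneousVector {K : Type*} [Field K] {V : Type*} {r : ℕ} (deg : Fin r → ℕ)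
    (v : Fin r → MvPolynomial V K) (n : ℕ) : Prop :=
  ∀ b, ∀ m ∈ (v b).support, m.degree + deg b = n

/-- A graded free resolution
`⋯ ⟶ F_2 ⟶ F_1 ⟶ F_0 ⟶ R/I ⟶ 0` with `F_i = ⨁_{b : Fin (rank i)} R(-deg i b)` of finite rank,
where `R = K[x_v : v ∈ V]` is standard graded and all maps are homogeneous of degree zero.
As `R/I` lives in nonnegative degrees, the shifts are taken in `ℕ`; for a minimal resolution this
is no restriction. -/
structure GradedFreeResolution {K : Type*} [Field K] {V : Type*}
    (I : Ideal (MvPolynomial V K)) where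
  /-- The rank of `F_i`. -/
  rank : ℕ → ℕ
  /-- The degrees of the basis elements of `F_i`. -/
  deg : (i : ℕ) → Fin (rank i) → ℕ
  /-- The differential `F_{i+1} ⟶ F_i`. -/
  d : (i : ℕ) → (Fin (rank (i + 1)) → MvPolynomial V K) →ₗ[MvPolynomial V K]
    (Fin (rank i) → MvPolynomial V K)
  /-- The augmentation `F_0 ⟶ R/I`. -/
  aug : (Fin (rank 0) → MvPolynomial V K) →ₗ[MvPolynomial V K] (MvPolynomial V K ⧸ I)
  d_homogeneous : ∀ i c, IsHomogeneousVector (deg i) (d i (Pi.single c 1)) (deg (i + 1) c)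
  aug_homogeneous : ∀ b, ∃ p : MvPolynomial V K, p.IsHomogeneous (deg 0 b) ∧
    aug (Pi.single b 1) = Ideal.Quotient.mk I p
  aug_surjective : Function.Surjective aug
  exact_zero : Function.Exact (d 0) aug
  exact_succ : ∀ i, Function.Exact (d (i + 1)) (d i)

namespace GradedFreeResolution

variable {K : Type*} [Field K] {V : Type*} {I : Ideal (MvPolynomial V K)}

/-- The resolution is minimal: the image of `F_{i+1}` lies in `𝔪 F_i` for every `i`, where `𝔪` is
the ideal generated by the variables; that is, the matrices of the differentials have no entry with
a nonzero constant term. -/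
def IsMinimal (F : GradedFreeResolution I) : Prop :=
  ∀ i c b, constantCoeff (F.d i (Pi.single c 1) b) = 0

/-- The number of summands `R(-j)` of `F_i`. -/
def numSummands (F : GradedFreeResolution I) (i j : ℕ) : ℕ :=
  (Finset.univ.filter fun b : Fin (F.rank i) => F.deg i b = j).card

end GradedFreeResolution

/-- `β_{i,j}(R/I) = β`: the module `R/I` has a minimal graded free resolution, and in every one of
them the number of summands `R(-j)` in homological degree `i` is `β`. -/
def IsGradedBettiNumber {K : Type*} [Field K] {V : Type*} (I : Ideal (MvPolynomial V K))
    (i j β : ℕ) : Prop :=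
  (∃ F : GradedFreeResolution I, F.IsMinimal) ∧
    ∀ F : GradedFreeResolution I, F.IsMinimal → F.numSummands i j = β

/-!
Only the linear strand of a minimal resolution `F` of `R/I(H)` matters. By minimality `F_0 = R`, and
the generators of `F_{n+1}` have degree at least `n + 2`. The generators of degree exactly `n + 2`
span a space `E n` of dimension `β_{n+1,n+2}`, and the differential between these generators has
linear entries, which gives maps `A v : E (n + 1) → E n`, one for each variable. Exactness of `F` in
the lowest degrees says that `E 0` is the space of quadrics of `I(H)`, and that `x ↦ (A v x)_v`
identifies `E (n + 1)` with the families `y` in `E n` for which `∑ v, x_v y_v` is a cycle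
(`GradedFreeResolution.IsMinimal.isLinearStrand`).

Following the maps `A v` down to the quadrics turns `E n` into the space of tensors
`∑ f(w; a, b) x_{w₁} ⊗ ⋯ ⊗ x_{wₙ} ⊗ x_a x_b` that are alternating in `w`, supported on edges `ab`, and
killed by multiplying `x_{wₙ}` into the quadric (`IsLinearStrand.isStrand`,
`IsLinearStrand.exists_strandMap_eq`). Let `a`, `b` have the first and the second colour of a
2-colouring. A cubic monomial has two variables of one colour, so the last condition says that `f`
changes sign when `wₙ` is swapped with the vertex of the same colour among `a`, `b`, and vanishes if
they are equal. Hence a nonzero coefficient stays nonzero when any two vertices of different colours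
are moved into the quadric (`IsStrand.exists_move`). So its vertices are distinct and induce a
complete bipartite graph meeting both colour classes, and on each such vertex set `f` is determined by
one value, which is arbitrary (`IsStrand.of_biclique`). Therefore `β_{n+1,n+2}` counts these sets
(`IsLinearStrand.finrank_eq`). They are the sets of `n + 2` vertices on which the complement of `H`
has two connected components, because each colour class is a clique of the complement
(`natCard_connectedComponent_compl_induce_eq_two_iff`).

Existence of a minimal resolution: cover the module of cycles by as few homogeneous generators as
possible, which leaves no constant coordinate in the kernel, and iterate
(`IsGradedSubmodule.exists_minimal_cover`).
-/

/-! ### Alternating tensors and bicliques -/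

section LinearStrand

variable {K : Type*} [Field K] {V : Type*}

/-- The sign of a list of distinct elements relative to the ranking `e`, and `0` on a list with a
repetition. -/
def listSign [DecidableEq V] (e : V → ℕ) : List V → K
  | [] => 1
  | a :: l => if a ∈ l then 0 else (-1) ^ (l.countP fun x => e x < e a) * listSign e l

theorem listSign_swap [DecidableEq V] {e : V → ℕ} (he : Function.Injective e) (l : List V)
    (u v : V) (w : List V) :
    (listSign e (l ++ u :: v :: w) : K) = -listSign e (l ++ v :: u :: w) := by
  induction l with
  | nil =>
    by_cases huv : u = v
    · subst huv; simp [listSign]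
    by_cases hu : u ∈ w
    · simp [listSign, hu]
    by_cases hv : v ∈ w
    · simp [listSign, hv]
    have hne : e u ≠ e v := fun h => huv (he h)
    rcases lt_or_gt_of_ne hne with h | h
    · simp [listSign, hu, hv, huv, Ne.symm huv, h, not_lt.2 h.le]
      ring
    · simp [listSign, hu, hv, huv, Ne.symm huv, h, not_lt.2 h.le]
      ring
  | cons x l ih =>
    have hp : (l ++ u :: v :: w).Perm (l ++ v :: u :: w) := (List.Perm.swap v u w).append_left l
    have hm : x ∈ l ++ u :: v :: w ↔ x ∈ l ++ v :: u :: w := hp.mem_iff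
    simp only [List.cons_append, listSign, hm, hp.countP_eq, ih]
    split_ifs <;> simp

theorem listSign_ne_zero_iff [DecidableEq V] (e : V → ℕ) (l : List V) :
    (listSign e l : K) ≠ 0 ↔ l.Nodup := by
  induction l with
  | nil => simp [listSign]
  | cons a l ih =>
    by_cases h : a ∈ l <;> simp [listSign, h, ← ih]

theorem exists_perm_concat_of_mem {w : List V} {a : V} (h : a ∈ w) : ∃ w', w.Perm (w' ++ [a]) := by
  classical
  exact ⟨w.erase a, (List.perm_cons_erase h).trans (List.perm_append_singleton _ _).symm⟩

/-- The linear strand of the edge ideal of a bipartite graph, in its tensor form: the value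
`f w a b` stands for the coefficient of `x_{w₁} ⊗ ⋯ ⊗ x_{wₙ} ⊗ x_a x_b`, where `a` lies in the colour
class `true` and `b` in the colour class `false`. The tensor is alternating in `w`, and its last
linear factor multiplies with the quadric to zero. -/
structure IsStrand (H : SimpleGraph V) (c : V → Bool) (n : ℕ) (f : List V → V → V → K) : Prop where
  supp : ∀ w a b, f w a b ≠ 0 → w.length = n ∧ c a = true ∧ c b = false ∧ H.Adj a b
  swap : ∀ l u v w, f (l ++ u :: v :: w) = -f (l ++ v :: u :: w)
  sq : ∀ l u w, f (l ++ u :: u :: w) = 0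
  left : ∀ l u a b, c u = true → c a = true → f (l ++ [u]) a b = -f (l ++ [a]) u b
  left_sq : ∀ l a b, f (l ++ [a]) a b = 0
  right : ∀ l u a b, c u = false → c b = false → f (l ++ [u]) a b = -f (l ++ [b]) a u
  right_sq : ∀ l a b, f (l ++ [b]) a b = 0

/-- The vertex set `S` has `k` elements, meets both colour classes, and induces a complete bipartite
graph. -/
def IsBiclique (H : SimpleGraph V) (c : V → Bool) (k : ℕ) (S : Finset V) : Prop :=
  S.card = k ∧ (∃ a ∈ S, c a = true) ∧ (∃ b ∈ S, c b = false) ∧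
    ∀ a ∈ S, ∀ b ∈ S, c a = true → c b = false → H.Adj a b

namespace IsStrand

variable {H : SimpleGraph V} {c : V → Bool} {n : ℕ} {f : List V → V → V → K}

theorem perm (hf : IsStrand H c n f) {w w' : List V} (h : w.Perm w') {a b : V} :
    f w a b ≠ 0 ↔ f w' a b ≠ 0 := by
  suffices ∀ l, f (l ++ w) a b ≠ 0 ↔ f (l ++ w') a b ≠ 0 from this []
  induction h with
  | nil => simp
  | cons x _ ih => intro l; simpa using ih (l ++ [x])
  | swap x y w => intro l; rw [hf.swap]; simp
  | trans _ _ ih ih' => exact fun l => (ih l).trans (ih' l)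

theorem nodup (hf : IsStrand H c n f) {w : List V} {a b : V} (h : f w a b ≠ 0) :
    (w ++ [a, b]).Nodup := by
  have ha : a ∉ w := fun ha => by
    obtain ⟨w', hw'⟩ := exists_perm_concat_of_mem ha
    exact (hf.perm hw').1 h (hf.left_sq _ _ _)
  have hb : b ∉ w := fun hb => by
    obtain ⟨w', hw'⟩ := exists_perm_concat_of_mem hb
    exact (hf.perm hw').1 h (hf.right_sq _ _ _)
  have hw : w.Nodup := by
    by_contra hw
    obtain ⟨x, hx⟩ := List.exists_duplicate_iff_not_nodup.2 hw
    obtain ⟨l, hl⟩ := (List.duplicate_iff_sublist.1 hx).exists_perm_append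
    exact (hf.perm hl).1 h (congrFun (congrFun (hf.sq [] x l) a) b)
  have hab := (hf.supp _ _ _ h).2.2.2.ne
  refine hw.append (by simpa using hab) ?_
  intro x hx hx'
  simp only [List.mem_cons, List.not_mem_nil, or_false] at hx'
  rcases hx' with rfl | rfl
  · exact ha hx
  · exact hb hx

/-- A nonzero coefficient stays nonzero when another pair of oppositely coloured vertices of its
support is moved into the quadric. -/
theorem exists_move (hf : IsStrand H c n f) {w : List V} {a b a' b' : V} (h : f w a b ≠ 0)
    (ha' : a' ∈ w ++ [a, b]) (hb' : b' ∈ w ++ [a, b]) (hca : c a' = true) (hcb : c b' = false) :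
    ∃ w', (w' ++ [a', b']).Perm (w ++ [a, b]) ∧ f w' a' b' ≠ 0 := by
  obtain ⟨-, ca, cb, -⟩ := hf.supp _ _ _ h
  obtain ⟨w₁, hp₁, h₁⟩ : ∃ w₁, (w₁ ++ [a', b]).Perm (w ++ [a, b]) ∧ f w₁ a' b ≠ 0 := by
    by_cases haa : a' = a
    · exact ⟨w, by rw [haa], by rwa [haa]⟩
    have hm : a' ∈ w := by
      have hab : a' ≠ b := by rintro rfl; simp_all
      simpa [haa, hab] using ha'
    obtain ⟨w₂, hw₂⟩ := exists_perm_concat_of_mem hm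
    refine ⟨w₂ ++ [a], ?_, ?_⟩
    · refine List.Perm.trans ?_ (hw₂.symm.append_right _)
      simpa using (List.Perm.swap _ _ _).append_left w₂
    · have := (hf.perm hw₂).1 h
      rw [hf.left _ _ _ _ hca ca] at this
      simpa using this
  by_cases hbb : b' = b
  · exact ⟨w₁, by rwa [hbb], by rwa [hbb]⟩
  have hm : b' ∈ w₁ := by
    have hab : b' ≠ a' := by rintro rfl; simp_all
    simpa [hbb, hab] using hp₁.mem_iff.2 hb'
  obtain ⟨w₂, hw₂⟩ := exists_perm_concat_of_mem hm
  refine ⟨w₂ ++ [b], ?_, ?_⟩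
  · refine List.Perm.trans ?_ ((hw₂.symm.append_right _).trans hp₁)
    simp only [List.append_assoc]
    refine List.Perm.append_left w₂ ?_
    exact ((List.Perm.swap _ _ _).trans ((List.Perm.swap _ _ _).cons _)).trans (List.Perm.swap _ _ _)
  · have := (hf.perm hw₂).1 h₁
    rw [hf.right _ _ _ _ hcb cb] at this
    simpa using this

theorem isBiclique [DecidableEq V] (hf : IsStrand H c n f) {w : List V} {a b : V}
    (h : f w a b ≠ 0) : IsBiclique H c (n + 2) (w ++ [a, b]).toFinset := by
  obtain ⟨hl, ca, cb, -⟩ := hf.supp _ _ _ h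
  refine ⟨?_, ⟨a, by simp, ca⟩, ⟨b, by simp, cb⟩, fun a' ha' b' hb' hca hcb => ?_⟩
  · rw [List.toFinset_card_of_nodup (hf.nodup h)]; simp [hl]
  · obtain ⟨w', -, h'⟩ := hf.exists_move h (List.mem_toFinset.1 ha') (List.mem_toFinset.1 hb') hca hcb
    exact (hf.supp _ _ _ h').2.2.2

/-- Whether a coefficient vanishes depends only on its set of vertices. -/
theorem ne_zero_of_perm (hf : IsStrand H c n f) {w w' : List V} {a b a' b' : V} (h : f w a b ≠ 0)
    (hp : (w' ++ [a', b']).Perm (w ++ [a, b])) (hca : c a' = true) (hcb : c b' = false) :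
    f w' a' b' ≠ 0 := by
  obtain ⟨w₂, hp₂, h₂⟩ := hf.exists_move h (hp.mem_iff.1 (by simp)) (hp.mem_iff.1 (by simp)) hca hcb
  exact (hf.perm ((List.perm_append_right_iff _).1 (hp₂.trans hp.symm))).1 h₂

theorem cons (hf : IsStrand H c (n + 1) f) (v : V) : IsStrand H c n fun w => f (v :: w) where
  supp w a b h := by simpa using hf.supp _ _ _ h
  swap l := hf.swap (v :: l)
  sq l := hf.sq (v :: l)
  left l := hf.left (v :: l)
  left_sq l := hf.left_sq (v :: l)
  right l := hf.right (v :: l)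
  right_sq l := hf.right_sq (v :: l)

/-- Functions on bicliques, spread out with signs over the orderings of each biclique, give elements
of the linear strand. -/
theorem of_biclique [DecidableEq V] {e : V → ℕ} (he : Function.Injective e) (h : Finset V → K)
    (hh : ∀ S, h S ≠ 0 → IsBiclique H c (n + 2) S) :
    IsStrand H c n fun w a b => if c a = true ∧ c b = false then
      listSign e (w ++ [a, b]) * h (w ++ [a, b]).toFinset else 0 where
  supp w a b hne := by
    split_ifs at hne with hc
    · have hS := hh _ (right_ne_zero_of_mul hne)
      have hcard := hS.1
      rw [List.toFinset_card_of_nodup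
        ((listSign_ne_zero_iff e _).1 (left_ne_zero_of_mul hne))] at hcard
      exact ⟨by simpa using hcard, hc.1, hc.2, hS.2.2.2 a (by simp) b (by simp) hc.1 hc.2⟩
    · exact absurd rfl hne
  swap l u v w := by
    funext a b
    have hS : (l ++ u :: v :: (w ++ [a, b])).toFinset = (l ++ v :: u :: (w ++ [a, b])).toFinset :=
      List.toFinset_eq_of_perm _ _ ((List.Perm.swap _ _ _).append_left l)
    simp only [List.append_assoc, List.cons_append, listSign_swap he l u v, hS, Pi.neg_apply]
    split_ifs <;> simp
  sq l u w := by
    funext a b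
    have : (listSign e (l ++ u :: u :: (w ++ [a, b])) : K) = 0 := by
      by_contra h0
      simpa using (List.nodup_append.1 ((listSign_ne_zero_iff e _).1 h0)).2.1
    simp [this]
  left l u a b hu ha := by
    have hS : (l ++ [u, a, b]).toFinset = (l ++ [a, u, b]).toFinset :=
      List.toFinset_eq_of_perm _ _ ((List.Perm.swap _ _ _).append_left l)
    simp only [List.append_assoc, List.cons_append, List.nil_append, listSign_swap he l u a, hS,
      hu, ha]
    split_ifs <;> simp
  left_sq l a b := by
    have : (listSign e (l ++ [a, a, b]) : K) = 0 := by
      by_contra h0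
      simpa using (List.nodup_append.1 ((listSign_ne_zero_iff e _).1 h0)).2.1
    simp [this]
  right l u a b hu hb := by
    have hp : ([u, a, b] : List V).Perm [b, a, u] :=
      ((List.Perm.swap _ _ _).trans ((List.Perm.swap _ _ _).cons _)).trans (List.Perm.swap _ _ _)
    have hS : (l ++ [u, a, b]).toFinset = (l ++ [b, a, u]).toFinset :=
      List.toFinset_eq_of_perm _ _ (hp.append_left l)
    have hsign : (listSign e (l ++ [u, a, b]) : K) = -listSign e (l ++ [b, a, u]) := by
      have h₁ := listSign_swap (K := K) he (l ++ [a]) u b []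
      simp only [List.append_assoc, List.cons_append, List.nil_append] at h₁
      rw [listSign_swap he l u a, h₁, listSign_swap he l a b, neg_neg]
    simp only [List.append_assoc, List.cons_append, List.nil_append, hsign, hS, hu, hb]
    split_ifs <;> simp
  right_sq l a b := by
    have : (listSign e (l ++ [b, a, b]) : K) = 0 := by
      by_contra h0
      simpa using (List.nodup_append.1 ((listSign_ne_zero_iff e _).1 h0)).2.1
    simp [this]

end IsStrand

theorem IsBiclique.exists_list [DecidableEq V] {H : SimpleGraph V} {c : V → Bool} {k : ℕ}
    {S : Finset V} (hS : IsBiclique H c k S) : ∃ (w : List V) (a b : V),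
      c a = true ∧ c b = false ∧ (w ++ [a, b]).Nodup ∧ (w ++ [a, b]).toFinset = S := by
  obtain ⟨-, ⟨a, ha, ca⟩, ⟨b, hb, cb⟩, -⟩ := hS
  have hab : a ≠ b := by rintro rfl; simp_all
  refine ⟨((S.erase a).erase b).toList, a, b, ca, cb, ?_, ?_⟩
  · refine (Finset.nodup_toList _).append (by simpa using hab) ?_
    intro x hx hx'
    simp only [List.mem_cons, List.not_mem_nil, or_false] at hx'
    rcases hx' with rfl | rfl <;> simp at hx
  · ext x
    by_cases h₁ : x = a
    · simp [h₁, ha]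
    by_cases h₂ : x = b
    · simp [h₂, hb]
    simp [h₁, h₂]

variable {E : ℕ → Type*} [∀ n, AddCommGroup (E n)] [∀ n, Module K (E n)]

/-- The embedding of the `n`-th term of a linear strand into tensors: follow the transition maps `A`
along the list of variables down to the quadrics. -/
def strandMap (base : E 0 →ₗ[K] V → V → K) (A : (n : ℕ) → V → E (n + 1) →ₗ[K] E n) :
    (n : ℕ) → List V → (E n →ₗ[K] V → V → K)
  | 0, [] => base
  | 0, _ :: _ => 0
  | _ + 1, [] => 0
  | n + 1, v :: w => strandMap base A n w ∘ₗ A n v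

/-- The axioms satisfied by the linear strand of a minimal free resolution: `E n` is the space of
basis elements of `F_{n+1}` of degree `n + 2`, embedded through the linear maps `A n v` (the
coefficients of the variable `x_v` in the differential) into the families of elements of `E (n - 1)`
as the kernel of the next differential; `E 0` is the space of quadrics in the ideal. -/
structure IsLinearStrand (H : SimpleGraph V) (c : V → Bool) (base : E 0 →ₗ[K] V → V → K)
    (A : (n : ℕ) → V → E (n + 1) →ₗ[K] E n) : Prop where
  base_supp : ∀ x a b, base x a b ≠ 0 → c a = true ∧ c b = false ∧ H.Adj a b
  base_surj : ∀ g : V → V → K, (∀ a b, g a b ≠ 0 → c a = true ∧ c b = false ∧ H.Adj a b) →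
    ∃ x, base x = g
  base_inj : ∀ x, base x = 0 → x = 0
  inj : ∀ n x, (∀ v, A n v x = 0) → x = 0
  exact_base : ∀ y : V → E 0, (∃ x, ∀ v, A 0 v x = y v) ↔
    (∀ u a b, c u = true → c a = true → base (y u) a b = -base (y a) u b) ∧
    (∀ a b, base (y a) a b = 0) ∧
    (∀ u a b, c u = false → c b = false → base (y u) a b = -base (y b) a u) ∧
    (∀ a b, base (y b) a b = 0)
  exact : ∀ n, ∀ y : V → E (n + 1), (∃ x, ∀ v, A (n + 1) v x = y v) ↔
    (∀ u v, A n u (y v) = -A n v (y u)) ∧ ∀ v, A n v (y v) = 0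

namespace IsLinearStrand

variable {H : SimpleGraph V} {c : V → Bool} {base : E 0 →ₗ[K] V → V → K}
  {A : (n : ℕ) → V → E (n + 1) →ₗ[K] E n}

/-- The coefficient tensors of the elements of `E n` satisfy the axioms of the linear strand. -/
theorem isStrand (h : IsLinearStrand H c base A) (n : ℕ) (x : E n) :
    IsStrand H c n fun w => strandMap base A n w x := by
  induction n with
  | zero =>
    have hs : ∀ w, w ≠ [] → strandMap base A 0 w = 0 := by
      rintro (_ | ⟨v, w⟩) hw
      · exact absurd rfl hw
      · rfl
    refine ⟨?_, ?_, ?_, ?_, ?_, ?_, ?_⟩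
    · rintro (_ | ⟨v, w⟩) a b hne
      · exact ⟨rfl, h.base_supp x a b hne⟩
      · exact absurd rfl hne
    all_goals intros; simp [hs]
  | succ n ih =>
    refine ⟨?_, ?_, ?_, ?_, ?_, ?_, ?_⟩
    · rintro (_ | ⟨v, w⟩) a b hne
      · exact absurd rfl hne
      · simpa using (ih (A n v x)).supp w a b hne
    · rintro (_ | ⟨t, l⟩) u v w
      · cases n with
        | zero => exact neg_zero.symm
        | succ m =>
          have := ((h.exact m fun v => A (m + 1) v x).1 ⟨x, fun _ => rfl⟩).1 v u
          simp [strandMap, this]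
      · exact (ih (A n t x)).swap l u v w
    · rintro (_ | ⟨t, l⟩) u w
      · cases n with
        | zero => rfl
        | succ m =>
          have := ((h.exact m fun v => A (m + 1) v x).1 ⟨x, fun _ => rfl⟩).2 u
          simp [strandMap, this]
      · exact (ih (A n t x)).sq l u w
    · rintro (_ | ⟨t, l⟩) u a b hu ha
      · cases n with
        | zero => exact ((h.exact_base fun v => A 0 v x).1 ⟨x, fun _ => rfl⟩).1 u a b hu ha
        | succ m => exact neg_zero.symm
      · exact (ih (A n t x)).left l u a b hu ha
    · rintro (_ | ⟨t, l⟩) a b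
      · cases n with
        | zero => exact ((h.exact_base fun v => A 0 v x).1 ⟨x, fun _ => rfl⟩).2.1 a b
        | succ m => rfl
      · exact (ih (A n t x)).left_sq l a b
    · rintro (_ | ⟨t, l⟩) u a b hu hb
      · cases n with
        | zero => exact ((h.exact_base fun v => A 0 v x).1 ⟨x, fun _ => rfl⟩).2.2.1 u a b hu hb
        | succ m => exact neg_zero.symm
      · exact (ih (A n t x)).right l u a b hu hb
    · rintro (_ | ⟨t, l⟩) a b
      · cases n with
        | zero => exact ((h.exact_base fun v => A 0 v x).1 ⟨x, fun _ => rfl⟩).2.2.2 a b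
        | succ m => rfl
      · exact (ih (A n t x)).right_sq l a b

theorem eq_zero_of_strandMap (h : IsLinearStrand H c base A) (n : ℕ) (x : E n)
    (hx : ∀ w, strandMap base A n w x = 0) : x = 0 := by
  induction n with
  | zero => exact h.base_inj x (hx [])
  | succ n ih => exact h.inj n x fun v => ih _ fun w => hx (v :: w)

/-- Conversely, every tensor satisfying these axioms comes from `E n`; together with the injectivity
of `strandMap`, the vanishing of all its values on `y v` gives the relations needed to lift `y`. -/
theorem exists_strandMap_eq (h : IsLinearStrand H c base A) (n : ℕ) (f : List V → V → V → K)
    (hf : IsStrand H c n f) : ∃ x, ∀ w, strandMap base A n w x = f w := by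
  have hlen : ∀ {n} {f : List V → V → V → K}, IsStrand H c n f → ∀ w, w.length ≠ n → f w = 0 := by
    intro n f hf w hw
    funext a b
    by_contra hne
    exact hw (hf.supp w a b hne).1
  induction n generalizing f with
  | zero =>
    obtain ⟨x, hx⟩ := h.base_surj (f []) fun a b hab => (hf.supp [] a b hab).2
    refine ⟨x, ?_⟩
    rintro (_ | ⟨v, w⟩)
    · exact hx
    · exact (hlen hf _ (by simp)).symm
  | succ n ih =>
    choose y hy using fun v => ih _ (hf.cons v)
    obtain ⟨x, hx⟩ : ∃ x, ∀ v, A n v x = y v := by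
      cases n with
      | zero =>
        have hy' : ∀ v, base (y v) = f [v] := fun v => hy v []
        refine (h.exact_base y).2 ⟨fun u a b => ?_, fun a b => ?_, fun u a b => ?_, fun a b => ?_⟩ <;>
          rw [hy']
        · rw [hy']; exact hf.left [] u a b
        · exact hf.left_sq [] a b
        · rw [hy']; exact hf.right [] u a b
        · exact hf.right_sq [] a b
      | succ m =>
        have hy' : ∀ u v w, strandMap base A m w (A m u (y v)) = f (v :: u :: w) :=
          fun u v w => hy v (u :: w)
        refine (h.exact m y).2 ⟨fun u v => ?_, fun v => ?_⟩
        · rw [← add_eq_zero_iff_eq_neg]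
          refine h.eq_zero_of_strandMap m _ fun w => ?_
          rw [map_add, hy', hy', add_eq_zero_iff_eq_neg]
          exact hf.swap [] v u w
        · refine h.eq_zero_of_strandMap m _ fun w => ?_
          rw [hy']
          exact hf.sq [] v w
    refine ⟨x, ?_⟩
    rintro (_ | ⟨v, w⟩)
    · exact (hlen hf _ (by simp)).symm
    · exact (congrArg (strandMap base A n w) (hx v)).trans (hy v w)

/-- An element of the strand is determined by one coefficient for each biclique, and these can be
prescribed. -/
theorem finrank_eq [Finite V] (h : IsLinearStrand H c base A) (n : ℕ) :
    Module.finrank K (E n) = {S : Finset V | IsBiclique H c (n + 2) S}.ncard := by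
  classical
  have := Fintype.ofFinite V
  let B := {S : Finset V // IsBiclique H c (n + 2) S}
  choose w a b ha hb hnd hS using fun S : B => S.2.exists_list
  let e : V → ℕ := fun v => Fintype.equivFin V v
  have he : Function.Injective e := Fin.val_injective.comp (Fintype.equivFin V).injective
  let L : E n →ₗ[K] B → K := LinearMap.pi fun S =>
    LinearMap.proj (b S) ∘ₗ LinearMap.proj (a S) ∘ₗ strandMap base A n (w S)
  have hL : ∀ x S, L x S = strandMap base A n (w S) x (a S) (b S) := fun _ _ => rfl
  have hbij : Function.Bijective L := by
    constructor
    · rw [injective_iff_map_eq_zero]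
      intro x hx
      refine h.eq_zero_of_strandMap n x fun l => ?_
      funext u v
      by_contra hne
      have hs := h.isStrand n x
      let S : B := ⟨_, hs.isBiclique hne⟩
      have hp : (w S ++ [a S, b S]).Perm (l ++ [u, v]) :=
        List.perm_of_nodup_nodup_toFinset_eq (hnd S) (hs.nodup hne) (hS S)
      exact hs.ne_zero_of_perm hne hp (ha S) (hb S) (congrFun hx S)
    · intro g
      let s : B → K := fun S => listSign e (w S ++ [a S, b S])
      have hs : ∀ S, s S ≠ 0 := fun S => (listSign_ne_zero_iff e _).2 (hnd S)
      obtain ⟨x, hx⟩ := h.exists_strandMap_eq n _ (IsStrand.of_biclique (H := H) (c := c) he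
        (fun S => if hS : IsBiclique H c (n + 2) S then (s ⟨S, hS⟩)⁻¹ * g ⟨S, hS⟩ else 0) (by
          intro S hne
          by_contra hS
          simp [hS] at hne))
      refine ⟨x, ?_⟩
      funext S
      rw [hL, hx]
      simp only [ha, hb, hS, S.2, and_self, if_true, dif_pos]
      exact mul_inv_cancel_left₀ (hs S) _
  rw [(LinearEquiv.ofBijective L hbij).finrank_eq, Module.finrank_fintype_fun_eq_card,
    ← Nat.card_eq_fintype_card]
  rfl

end IsLinearStrand
end LinearStrand

/-! ### Connected components of the complement -/

/-- Each colour class is a clique of the complement, so the complement on `S` has at most two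
components, and it has two exactly if no edge of it joins the two nonempty classes. -/
theorem natCard_connectedComponent_compl_induce_eq_two_iff {V : Type*} {H : SimpleGraph V}
    {c : V → Bool} (hc : ∀ u v, H.Adj u v → c u ≠ c v) (S : Finset V) :
    Nat.card (Hᶜ.induce (S : Set V)).ConnectedComponent = 2 ↔ IsBiclique H c S.card S := by
  set G := Hᶜ.induce (S : Set V) with hG
  have hadj : ∀ x y : (S : Set V), x ≠ y → ¬H.Adj x y → G.Adj x y := fun x y hne h =>
    (SimpleGraph.compl_adj ..).2 ⟨fun h' => hne (Subtype.ext h'), h⟩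
  have hsame : ∀ x y : (S : Set V), c x = c y →
      G.connectedComponentMk x = G.connectedComponentMk y := by
    intro x y hxy
    by_cases h : x = y
    · rw [h]
    exact SimpleGraph.ConnectedComponent.sound
      (hadj x y h fun h' => hc _ _ h' hxy).reachable
  constructor
  · intro h2
    have hne : ∃ x y : (S : Set V), G.connectedComponentMk x ≠ G.connectedComponentMk y := by
      by_contra! hall
      have : Subsingleton G.ConnectedComponent :=
        ⟨fun p q => by
          induction p using SimpleGraph.ConnectedComponent.ind
          induction q using SimpleGraph.ConnectedComponent.ind
          exact hall _ _⟩
      have := Finite.card_le_one_iff_subsingleton.2 this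
      omega
    obtain ⟨x, y, hxy⟩ := hne
    have hcxy : c x ≠ c y := fun h => hxy (hsame x y h)
    wlog hx : c x = true generalizing x y
    · exact this y x hxy.symm hcxy.symm (by revert hcxy hx; cases c x <;> cases c y <;> simp)
    have hy : c y = false := by rw [hx] at hcxy; simpa using hcxy.symm
    refine ⟨rfl, ⟨x, x.2, hx⟩, ⟨y, y.2, hy⟩, fun a ha b hb hca hcb => ?_⟩
    by_contra hab
    refine hxy ?_
    have hne : (⟨a, ha⟩ : (S : Set V)) ≠ ⟨b, hb⟩ := by
      intro h
      rw [Subtype.mk.injEq] at h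
      rw [h, hcb] at hca
      exact Bool.noConfusion hca
    rw [hsame x ⟨a, ha⟩ (hx.trans hca.symm), hsame y ⟨b, hb⟩ (hy.trans hcb.symm)]
    exact SimpleGraph.ConnectedComponent.sound (hadj _ _ hne hab).reachable
  · rintro ⟨-, ⟨a, ha, hca⟩, ⟨b, hb, hcb⟩, hall⟩
    have hcolor : ∀ x y, G.Reachable x y → c x = c y := by
      rintro x y ⟨p⟩
      induction p with
      | nil => rfl
      | @cons x y z h _ ih =>
        rw [← ih]
        have h' : ¬H.Adj x y := ((SimpleGraph.compl_adj ..).1 h).2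
        by_contra hne
        cases hx : c x <;> cases hy : c y <;> simp [hx, hy] at hne
        · exact h' (hall y y.2 x x.2 hy hx).symm
        · exact h' (hall x x.2 y y.2 hx hy)
    let φ : G.ConnectedComponent → Bool :=
      Quot.lift (fun x => c x) fun x y h => hcolor x y h
    have hφ : Function.Bijective φ := by
      constructor
      · intro p q
        induction p using SimpleGraph.ConnectedComponent.ind
        induction q using SimpleGraph.ConnectedComponent.ind
        exact hsame _ _
      · rintro (_ | _)
        · exact ⟨G.connectedComponentMk ⟨b, hb⟩, hcb⟩
        · exact ⟨G.connectedComponentMk ⟨a, ha⟩, hca⟩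
    rw [Nat.card_eq_of_bijective φ hφ]
    simp

/-! ### Coefficients of quadrics and cubics -/

section Coefficients

variable {K : Type*} [Field K] {V : Type*}

/-- If `q` has no monomials below the degree of `m`, only the constant term of `p` contributes to the
coefficient of `m` in `p * q`. -/
theorem coeff_mul_of_degree_le {m : V →₀ ℕ} {p q : MvPolynomial V K}
    (hq : ∀ m' ∈ q.support, m.degree ≤ m'.degree) :
    coeff m (p * q) = constantCoeff p * coeff m q := by
  classical
  rw [coeff_mul, Finset.sum_eq_single (0, m)]
  · rfl
  · rintro ⟨s, t⟩ hst hne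
    rw [Finset.HasAntidiagonal.mem_antidiagonal] at hst
    by_cases ht : t ∈ q.support
    · have h₁ := hq t ht
      have h₂ : s.degree + t.degree = m.degree := by rw [← map_add, hst]
      have hs : s = 0 := (Finsupp.degree_eq_zero_iff s).1 (by omega)
      subst hs
      simp only [zero_add] at hst
      exact absurd (by rw [hst]) hne
    · rw [notMem_support_iff.1 ht, mul_zero]
  · intro h
    simp at h

theorem X_mul_C_eq_monomial (v : V) (k : K) : X v * C k = monomial (Finsupp.single v 1) k := by
  rw [mul_comm, C_mul_X_eq_monomial]

theorem single_add_single_eq_iff {s t u v : V} :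
    Finsupp.single u 1 + Finsupp.single v 1 = (Finsupp.single s 1 + Finsupp.single t 1 : V →₀ ℕ) ↔
      (u = s ∧ v = t) ∨ (u = t ∧ v = s) := by
  classical
  constructor
  · intro h
    have h₁ := DFunLike.congr_fun h s
    have h₂ := DFunLike.congr_fun h t
    simp only [Finsupp.add_apply, Finsupp.single_apply] at h₁ h₂
    grind
  · rintro (⟨rfl, rfl⟩ | ⟨rfl, rfl⟩)
    · rfl
    · exact add_comm _ _

theorem exists_eq_single_of_degree_eq_one {m : V →₀ ℕ} (h : m.degree = 1) :
    ∃ v, m = Finsupp.single v 1 := by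
  have : m ∈ {d : V →₀ ℕ | d.degree = 1} := h
  rw [← Finsupp.range_single_one] at this
  obtain ⟨v, hv⟩ := this
  exact ⟨v, hv.symm⟩

theorem exists_eq_single_add_single_of_degree_eq_two {m : V →₀ ℕ} (h : m.degree = 2) :
    ∃ u v, m = Finsupp.single u 1 + Finsupp.single v 1 := by
  obtain ⟨t, ht, ht'⟩ := Finsupp.exists_le_degree_eq m 1 (by omega)
  obtain ⟨u, rfl⟩ := exists_eq_single_of_degree_eq_one ht'
  obtain ⟨s, rfl⟩ := exists_add_of_le ht
  rw [map_add, ht'] at h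
  obtain ⟨v, rfl⟩ := exists_eq_single_of_degree_eq_one (m := s) (by omega)
  exact ⟨u, v, rfl⟩

variable [Fintype V]

theorem eq_sum_of_degree_eq_one {p : MvPolynomial V K} (hp : ∀ m ∈ p.support, m.degree = 1) :
    p = ∑ v, X v * C (coeff (Finsupp.single v 1) p) := by
  classical
  ext m
  simp only [X_mul_C_eq_monomial, coeff_sum, coeff_monomial]
  by_cases h1 : m.degree = 1
  · obtain ⟨u, rfl⟩ := exists_eq_single_of_degree_eq_one h1
    simp [Finsupp.single_left_inj]
  · rw [notMem_support_iff.1 fun hm => h1 (hp m hm), Finset.sum_eq_zero]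
    intro v _
    rw [if_neg]
    rintro rfl
    exact h1 (Finsupp.degree_single _ _)

/-- The quadratic form `∑ u v, B u v * x_u * x_v`. -/
noncomputable def quad (B : V → V → K) : MvPolynomial V K :=
  ∑ u, X u * ∑ v, X v * C (B u v)

theorem quad_eq_sum_monomial (B : V → V → K) :
    quad B = ∑ u, ∑ v, monomial (Finsupp.single u 1 + Finsupp.single v 1) (B u v) := by
  refine Finset.sum_congr rfl fun u _ => ?_
  rw [Finset.mul_sum]
  refine Finset.sum_congr rfl fun v _ => ?_
  rw [← mul_assoc, mul_comm, X, X, monomial_mul, C_mul_monomial, mul_one, mul_one]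

theorem coeff_quad [DecidableEq V] (B : V → V → K) (s t : V) :
    coeff (Finsupp.single s 1 + Finsupp.single t 1) (quad B) =
      if s = t then B s s else B s t + B t s := by
  simp only [quad_eq_sum_monomial, coeff_sum, coeff_monomial, single_add_single_eq_iff]
  split_ifs with h
  · subst h
    simp [ite_and]
  · have : ∀ u v, (if (u = s ∧ v = t) ∨ (u = t ∧ v = s) then B u v else 0) =
        (if u = s then if v = t then B u v else 0 else 0) +
          if u = t then if v = s then B u v else 0 else 0 := by
      intro u v
      by_cases h₁ : u = s <;> by_cases h₂ : u = t <;> simp_all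
    simp [this, Finset.sum_add_distrib]

theorem quad_eq_zero_iff (B : V → V → K) :
    quad B = 0 ↔ (∀ u v, B u v = -B v u) ∧ ∀ v, B v v = 0 := by
  classical
  constructor
  · intro h
    have hdiag : ∀ v, B v v = 0 := fun v => by
      have := coeff_quad B v v
      rwa [h, if_pos rfl, coeff_zero, eq_comm] at this
    refine ⟨fun u v => ?_, hdiag⟩
    by_cases huv : u = v
    · subst huv; simp [hdiag]
    have := coeff_quad B u v
    rwa [h, if_neg huv, coeff_zero, eq_comm, add_eq_zero_iff_eq_neg] at this
  · rintro ⟨h₁, h₂⟩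
    rw [quad_eq_sum_monomial, ← Fintype.sum_prod_type']
    refine Finset.sum_involution (fun p _ => p.swap) ?_ ?_ (by simp) (by simp)
    · rintro ⟨u, v⟩ -
      simp only [Prod.fst_swap, Prod.snd_swap]
      rw [h₁ u v, add_comm (Finsupp.single v 1), ← map_add, neg_add_cancel, map_zero]
    · rintro ⟨u, v⟩ - hne heq
      simp only [Prod.swap_prod_mk, Prod.mk.injEq] at heq
      obtain ⟨rfl, -⟩ := heq
      simp [h₂] at hne

theorem coeff_sum_X_mul_of_ne [DecidableEq V] (p : V → MvPolynomial V K) {u a b : V} (hua : u ≠ a)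
    (hub : u ≠ b) (hab : a ≠ b) :
    coeff (Finsupp.single u 1 + Finsupp.single a 1 + Finsupp.single b 1) (∑ v, X v * p v) =
      coeff (Finsupp.single a 1 + Finsupp.single b 1) (p u) +
      (coeff (Finsupp.single u 1 + Finsupp.single b 1) (p a) +
      coeff (Finsupp.single u 1 + Finsupp.single a 1) (p b)) := by
  have hs : (Finsupp.single u 1 + Finsupp.single a 1 + Finsupp.single b 1 : V →₀ ℕ).support =
      {u, a, b} := by
    ext x
    simp [Finsupp.single_apply, Finset.mem_insert, or_iff_not_imp_left, eq_comm]
  simp only [coeff_sum, coeff_X_mul', hs, Finset.sum_ite_mem, Finset.univ_inter]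
  rw [Finset.sum_insert (by simp [hua, hub]), Finset.sum_insert (by simp [hab]),
    Finset.sum_singleton]
  congr 3
  · rw [add_assoc, add_tsub_cancel_left]
  · rw [add_right_comm, add_tsub_cancel_right]
  · rw [add_tsub_cancel_right]

theorem coeff_sum_X_mul_of_sq [DecidableEq V] (p : V → MvPolynomial V K) {a b : V} (hab : a ≠ b) :
    coeff (Finsupp.single a 1 + Finsupp.single a 1 + Finsupp.single b 1) (∑ v, X v * p v) =
      coeff (Finsupp.single a 1 + Finsupp.single b 1) (p a) +
      coeff (Finsupp.single a 1 + Finsupp.single a 1) (p b) := by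
  have hs : (Finsupp.single a 1 + Finsupp.single a 1 + Finsupp.single b 1 : V →₀ ℕ).support =
      {a, b} := by
    ext x
    simp [Finsupp.single_apply, Finset.mem_insert, or_iff_not_imp_left, eq_comm]
  simp only [coeff_sum, coeff_X_mul', hs, Finset.sum_ite_mem, Finset.univ_inter]
  rw [Finset.sum_insert (by simp [hab]), Finset.sum_singleton]
  congr 2
  · rw [add_assoc, add_tsub_cancel_left]
  · rw [add_tsub_cancel_right]

/-- The linear syzygies of quadrics supported on pairs of opposite colours. A monomial of such a
cubic has two variables of one colour, so the cubic splits into quadratic forms in the variables of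
either colour. -/
theorem sum_X_mul_quad_eq_zero_iff {c : V → Bool} {g : V → V → V → K}
    (hg : ∀ v a b, g v a b ≠ 0 → c a = true ∧ c b = false) :
    ∑ v, X v * quad (g v) = 0 ↔
      (∀ u a b, c u = true → c a = true → g u a b = -g a u b) ∧
      (∀ a b, g a a b = 0) ∧
      (∀ u a b, c u = false → c b = false → g u a b = -g b a u) ∧
      (∀ a b, g b a b = 0) := by
  classical
  have hl : ∀ v a b, c a = false → g v a b = 0 := fun v a b h => by
    by_contra hne; exact absurd (hg v a b hne).1 (by simp [h])
  have hr : ∀ v a b, c b = true → g v a b = 0 := fun v a b h => by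
    by_contra hne; exact absurd (hg v a b hne).2 (by simp [h])
  constructor
  · intro h
    have hc : ∀ v s t, c s ≠ c t →
        coeff (Finsupp.single s 1 + Finsupp.single t 1) (quad (g v)) = g v s t + g v t s := by
      intro v s t hst
      rw [coeff_quad, if_neg fun h => hst (congrArg c h)]
    have hc' : ∀ v s t, c s = c t →
        coeff (Finsupp.single s 1 + Finsupp.single t 1) (quad (g v)) = 0 := by
      intro v s t hst
      rw [coeff_quad]
      cases hs : c s
      · rw [hl _ _ _ hs, hl _ _ _ hs, hl _ _ _ (hst ▸ hs)]; simp
      · rw [hr _ _ _ hs, hr _ _ _ hs, hr _ _ _ (hst ▸ hs)]; simp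
    have hsq : ∀ a b, c a ≠ c b → g a a b + g a b a = 0 := by
      intro a b hab
      have := coeff_sum_X_mul_of_sq (fun v => quad (g v)) fun h => hab (congrArg c h)
      rwa [h, coeff_zero, hc _ _ _ hab, hc' _ _ _ rfl, add_zero, eq_comm] at this
    have hne : ∀ u a b, u ≠ a → c u = c a → c a ≠ c b →
        (g u a b + g u b a) + (g a u b + g a b u) = 0 := by
      intro u a b hua h₁ h₂
      have h₃ : c u ≠ c b := h₁ ▸ h₂
      have := coeff_sum_X_mul_of_ne (fun v => quad (g v)) hua (fun h => h₃ (congrArg c h))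
        fun h => h₂ (congrArg c h)
      rwa [h, coeff_zero, hc _ _ _ h₂, hc _ _ _ h₃, hc' _ _ _ h₁, add_zero, eq_comm] at this
    have hleft : ∀ a b, g a a b = 0 := by
      intro a b
      cases ha : c a
      · exact hl _ _ _ ha
      cases hb : c b
      · have := hsq a b (by simp [ha, hb])
        rwa [hr a b a ha, add_zero] at this
      · exact hr _ _ _ hb
    have hright : ∀ a b, g b a b = 0 := by
      intro a b
      cases ha : c a
      · exact hl _ _ _ ha
      cases hb : c b
      · have := hsq b a (by simp [ha, hb])
        rwa [hl b b a hb, zero_add] at this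
      · exact hr _ _ _ hb
    refine ⟨fun u a b hu ha => ?_, hleft, fun u a b hu hb => ?_, hright⟩
    · by_cases hua : u = a
      · subst hua; simp [hleft]
      cases hb : c b
      · have := hne u a b hua (hu.trans ha.symm) (by simp [ha, hb])
        rw [hr u b a ha, hr a b u hu, add_zero, add_zero] at this
        exact eq_neg_of_add_eq_zero_left this
      · rw [hr _ _ _ hb, hr _ _ _ hb, neg_zero]
    · by_cases hub : u = b
      · subst hub; simp [hright]
      cases ha : c a
      · rw [hl _ _ _ ha, hl _ _ _ ha, neg_zero]
      · have := hne u b a hub (hu.trans hb.symm) (by simp [ha, hb])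
        rw [hl u b a hb, hl b u a hu, zero_add, zero_add] at this
        exact eq_neg_of_add_eq_zero_left this
  · rintro ⟨h₁, h₂, h₃, h₄⟩
    have hA : ∀ b, quad (fun v a => if c v = true then g v a b else 0) = 0 := by
      intro b
      refine (quad_eq_zero_iff _).2 ⟨fun v a => ?_, fun v => by simp [h₂]⟩
      cases hv : c v <;> cases ha : c a
      · simp
      · simp [hl _ _ _ hv]
      · simp [hl _ _ _ ha]
      · simpa using h₁ v a b hv ha
    have hB : ∀ a, quad (fun v b => if c v = true then 0 else g v a b) = 0 := by
      intro a
      refine (quad_eq_zero_iff _).2 ⟨fun v b => ?_, fun v => by simp [h₄]⟩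
      cases hv : c v <;> cases hb : c b
      · simpa using h₃ v a b hv hb
      · simp [hr _ _ _ hb]
      · simp [hr _ _ _ hv]
      · simp
    -- the first variable has the colour of exactly one of the two variables of the quadric
    have hsplit : ∑ v, X v * quad (g v) =
        ∑ b, X b * quad (fun v a => if c v = true then g v a b else 0) +
          ∑ a, X a * quad (fun v b => if c v = true then 0 else g v a b) := by
      have e₁ : ∑ v, X v * quad (g v) =
          ∑ v, ∑ a, ∑ b, X v * (X a * (X b * C (g v a b))) := by
        simp only [quad, Finset.mul_sum]
      have e₂ : ∑ b, X b * quad (fun v a => if c v = true then g v a b else 0) =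
          ∑ v, ∑ a, ∑ b, X v * (X a * (X b * C (if c v = true then g v a b else 0))) := by
        simp only [quad, Finset.mul_sum]
        rw [Finset.sum_comm]
        refine Finset.sum_congr rfl fun v _ => ?_
        rw [Finset.sum_comm]
        refine Finset.sum_congr rfl fun a _ => Finset.sum_congr rfl fun b _ => ?_
        ring
      have e₃ : ∑ a, X a * quad (fun v b => if c v = true then 0 else g v a b) =
          ∑ v, ∑ a, ∑ b, X v * (X a * (X b * C (if c v = true then 0 else g v a b))) := by
        simp only [quad, Finset.mul_sum]
        rw [Finset.sum_comm]
        refine Finset.sum_congr rfl fun v _ => Finset.sum_congr rfl fun a _ =>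
          Finset.sum_congr rfl fun b _ => ?_
        ring
      rw [e₁, e₂, e₃]
      simp only [← Finset.sum_add_distrib]
      refine Finset.sum_congr rfl fun v _ => Finset.sum_congr rfl fun a _ =>
          Finset.sum_congr rfl fun b _ => ?_
      split_ifs <;> simp
    rw [hsplit]
    simp [hA, hB]

end Coefficients

/-! ### The edge ideal -/

section EdgeIdeal

variable {K : Type*} [Field K] {V : Type*} {H : SimpleGraph V}

theorem mem_edgeIdeal_iff {p : MvPolynomial V K} : p ∈ edgeIdeal K H ↔
    ∀ m ∈ p.support, ∃ u v, H.Adj u v ∧ Finsupp.single u 1 + Finsupp.single v 1 ≤ m := by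
  have : {p : MvPolynomial V K | ∃ u v : V, H.Adj u v ∧ p = X u * X v} =
      (fun s => monomial s (1 : K)) ''
        {s | ∃ u v, H.Adj u v ∧ s = Finsupp.single u 1 + Finsupp.single v 1} := by
    ext p
    constructor
    · rintro ⟨u, v, h, rfl⟩
      exact ⟨_, ⟨u, v, h, rfl⟩, by simp [X, monomial_mul]⟩
    · rintro ⟨_, ⟨u, v, h, rfl⟩, rfl⟩
      exact ⟨u, v, h, by simp [X, monomial_mul]⟩
  rw [edgeIdeal, this, mem_ideal_span_monomial_image]
  refine forall₂_congr fun m _ => ⟨?_, ?_⟩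
  · rintro ⟨_, ⟨u, v, h, rfl⟩, hs⟩
    exact ⟨u, v, h, hs⟩
  · rintro ⟨u, v, h, hs⟩
    exact ⟨_, ⟨u, v, h, rfl⟩, hs⟩

theorem two_le_degree_of_mem_edgeIdeal {p : MvPolynomial V K} (hp : p ∈ edgeIdeal K H)
    {m : V →₀ ℕ} (hm : m ∈ p.support) : 2 ≤ m.degree := by
  obtain ⟨u, v, -, h⟩ := mem_edgeIdeal_iff.1 hp m hm
  simpa [Finsupp.degree_single] using Finsupp.degree_mono h

theorem constantCoeff_of_mem_edgeIdeal {p : MvPolynomial V K} (hp : p ∈ edgeIdeal K H) :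
    constantCoeff p = 0 := by
  by_contra h
  have := two_le_degree_of_mem_edgeIdeal hp (m := 0) (mem_support_iff.2 h)
  simp at this

theorem adj_of_coeff_ne_zero_of_mem_edgeIdeal {p : MvPolynomial V K} (hp : p ∈ edgeIdeal K H)
    {a b : V} (h : coeff (Finsupp.single a 1 + Finsupp.single b 1) p ≠ 0) : H.Adj a b := by
  obtain ⟨u, v, huv, hle⟩ := mem_edgeIdeal_iff.1 hp _ (mem_support_iff.2 h)
  obtain ⟨s, hs⟩ := exists_add_of_le hle
  have hd := congrArg Finsupp.degree hs
  simp only [map_add, Finsupp.degree_single] at hd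
  have h0 : s = 0 := (Finsupp.degree_eq_zero_iff s).1 (by omega)
  rw [h0, add_zero, single_add_single_eq_iff] at hs
  rcases hs with ⟨rfl, rfl⟩ | ⟨rfl, rfl⟩
  · exact huv
  · exact huv.symm

/-- A quadric in the edge ideal, recovered from its coefficients at the pairs `(a, b)` of vertices of
colours `true` and `false`. -/
theorem eq_quad_of_mem_edgeIdeal [Fintype V] {c : V → Bool} (hc : ∀ u v, H.Adj u v → c u ≠ c v)
    {p : MvPolynomial V K} (hp : p ∈ edgeIdeal K H) (h2 : ∀ m ∈ p.support, m.degree = 2) :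
    p = quad fun a b => if c a = true ∧ c b = false then
      coeff (Finsupp.single a 1 + Finsupp.single b 1) p else 0 := by
  classical
  ext m
  by_cases hm : m.degree = 2
  · obtain ⟨s, t, rfl⟩ := exists_eq_single_add_single_of_degree_eq_two hm
    rw [coeff_quad]
    have hst : c s = c t → coeff (Finsupp.single s 1 + Finsupp.single t 1) p = 0 := fun h => by
      by_contra hne
      exact hc _ _ (adj_of_coeff_ne_zero_of_mem_edgeIdeal hp hne) h
    by_cases h : s = t
    · subst h; simp [hst rfl]
    rw [if_neg h, add_comm (Finsupp.single t 1)]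
    cases hs : c s <;> cases ht : c t <;> simp [hst, hs, ht]
  · rw [notMem_support_iff.1 fun h => hm (h2 m h), quad_eq_sum_monomial]
    simp only [coeff_sum, coeff_monomial]
    refine (Finset.sum_eq_zero fun u _ => Finset.sum_eq_zero fun v _ => if_neg ?_).symm
    rintro rfl
    exact hm (by simp [Finsupp.degree_single])

theorem quad_mem_edgeIdeal [Fintype V] {B : V → V → K} (hB : ∀ a b, B a b ≠ 0 → H.Adj a b) :
    quad B ∈ edgeIdeal K H := by
  refine Ideal.sum_mem _ fun u _ => ?_
  rw [Finset.mul_sum]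
  refine Ideal.sum_mem _ fun v _ => ?_
  by_cases h : B u v = 0
  · simp [h]
  · rw [← mul_assoc]
    exact Ideal.mul_mem_right _ _ (Ideal.subset_span ⟨u, v, hB _ _ h, rfl⟩)

end EdgeIdeal

/-! ### The linear strand of a minimal resolution -/

section HomogeneousVector

variable {K : Type*} [Field K] {V : Type*}

theorem linearMap_eq_sum_smul {r : ℕ} {M : Type*} [AddCommGroup M] [Module (MvPolynomial V K) M]
    (d : (Fin r → MvPolynomial V K) →ₗ[MvPolynomial V K] M) (x : Fin r → MvPolynomial V K) :
    d x = ∑ c, x c • d (Pi.single c 1) := by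
  rw [LinearMap.pi_apply_eq_sum_univ d x]
  refine Finset.sum_congr rfl fun c _ => ?_
  have : (fun j => if c = j then (1 : MvPolynomial V K) else 0) = Pi.single c 1 := by
    funext j
    simp [Pi.single_apply, eq_comm]
  rw [this]

theorem linearMap_apply_eq_sum {r s : ℕ}
    (d : (Fin r → MvPolynomial V K) →ₗ[MvPolynomial V K] (Fin s → MvPolynomial V K))
    (x : Fin r → MvPolynomial V K) (b : Fin s) :
    d x b = ∑ c, x c * d (Pi.single c 1) b := by
  rw [linearMap_eq_sum_smul d x, Finset.sum_apply]
  rfl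

theorem IsHomogeneousVector.map {r s : ℕ} {deg : Fin r → ℕ} {deg' : Fin s → ℕ}
    {d : (Fin r → MvPolynomial V K) →ₗ[MvPolynomial V K] (Fin s → MvPolynomial V K)}
    (hd : ∀ c, IsHomogeneousVector deg' (d (Pi.single c 1)) (deg c))
    {x : Fin r → MvPolynomial V K} {n : ℕ} (hx : IsHomogeneousVector deg x n) :
    IsHomogeneousVector deg' (d x) n := by
  classical
  intro b m hm
  rw [linearMap_apply_eq_sum] at hm
  obtain ⟨c, -, hc⟩ := Finset.mem_biUnion.1 (support_sum hm)
  obtain ⟨m₁, h₁, m₂, h₂, rfl⟩ := Finset.mem_add.1 (support_mul _ _ hc)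
  have e₁ := hx c m₁ h₁
  have e₂ := hd c b m₂ h₂
  rw [map_add]
  omega

end HomogeneousVector

namespace GradedFreeResolution

variable {K : Type*} [Field K] {V : Type*} {I : Ideal (MvPolynomial V K)}
  {F : GradedFreeResolution I}

theorem IsMinimal.constantCoeff_d (hF : F.IsMinimal) (i : ℕ)
    (x : Fin (F.rank (i + 1)) → MvPolynomial V K) (b : Fin (F.rank i)) :
    constantCoeff (F.d i x b) = 0 := by
  rw [linearMap_apply_eq_sum, map_sum]
  exact Finset.sum_eq_zero fun c _ => by rw [map_mul, hF, mul_zero]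

theorem IsMinimal.constantCoeff_of_d_eq_zero (hF : F.IsMinimal) {i : ℕ}
    {x : Fin (F.rank (i + 1)) → MvPolynomial V K} (hx : F.d i x = 0) (b : Fin (F.rank (i + 1))) :
    constantCoeff (x b) = 0 := by
  obtain ⟨t, rfl⟩ := (F.exact_succ i x).1 hx
  exact hF.constantCoeff_d _ _ _

/-- In a minimal resolution of `R/I` with `I` contained in the irrelevant ideal, `F_0` is the ring,
generated in degree zero. -/
theorem IsMinimal.exists_zero (hF : F.IsMinimal) (hI : ∀ p ∈ I, constantCoeff p = 0) :
    ∃ b₀ : Fin (F.rank 0), (∀ b, b = b₀) ∧ F.deg 0 b₀ = 0 ∧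
      ∀ x, (∃ t, F.d 0 t = x) ↔ x b₀ ∈ I := by
  choose p hp hpa using F.aug_homogeneous
  have haug : ∀ x, F.aug x = Ideal.Quotient.mk I (∑ b, x b * p b) := by
    intro x
    rw [linearMap_eq_sum_smul F.aug x, map_sum]
    refine Finset.sum_congr rfl fun b _ => ?_
    rw [hpa]
    rfl
  have hker : ∀ x, F.aug x = 0 → ∀ b, constantCoeff (x b) = 0 := by
    intro x hx b
    obtain ⟨t, rfl⟩ := (F.exact_zero x).1 hx
    exact hF.constantCoeff_d _ _ _
  obtain ⟨b₀, hb₀⟩ : ∃ b₀, constantCoeff (p b₀) ≠ 0 := by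
    by_contra! hall
    obtain ⟨x, hx⟩ := F.aug_surjective 1
    rw [haug, ← map_one (Ideal.Quotient.mk I), Ideal.Quotient.eq] at hx
    have := hI _ hx
    rw [map_sub, map_sum, Finset.sum_eq_zero fun b _ => by rw [map_mul, hall, mul_zero]] at this
    simp at this
  have hdeg : F.deg 0 b₀ = 0 := by
    have := hp b₀ (d := 0) hb₀
    simpa using this.symm
  obtain ⟨k, hk⟩ : ∃ k, p b₀ = C k := by
    have := hp b₀
    rw [hdeg] at this
    exact ⟨_, totalDegree_eq_zero_iff_eq_C.1 ((totalDegree_zero_iff_isHomogeneous _).2 this)⟩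
  have hk0 : k ≠ 0 := by rintro rfl; simp [hk] at hb₀
  have huniq : ∀ b, b = b₀ := by
    intro b
    by_contra hne
    -- a second generator would give an element of the kernel with the nonzero constant `k` at `b`
    let x : Fin (F.rank 0) → MvPolynomial V K := Pi.single b (C k) - Pi.single b₀ (p b)
    have hx : F.aug x = 0 := by
      have hs : ∑ j, x j * p j = C k * p b - p b * p b₀ := by
        simp only [x, Pi.sub_apply, sub_mul, Finset.sum_sub_distrib, Pi.single_apply, ite_mul,
          zero_mul, Finset.sum_ite_eq', Finset.mem_univ, if_true]
      rw [haug, hs, hk, mul_comm, sub_self, map_zero]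
    have := hker x hx b
    simp [x, hne, hk0] at this
  refine ⟨b₀, huniq, hdeg, fun x => ?_⟩
  have hsum : ∑ b, x b * p b = x b₀ * C k := by
    rw [← hk]
    exact Finset.sum_eq_single b₀ (fun b _ h => absurd (huniq b) h) (by simp)
  refine (F.exact_zero x).symm.trans ?_
  rw [haug, hsum, Ideal.Quotient.eq_zero_iff_mem]
  exact Ideal.mul_unit_mem_iff_mem I ((isUnit_iff_ne_zero.2 hk0).map C)

/-- In a minimal resolution of `R/I` with `I` generated in degrees at least two, the generators of
`F_{i+1}` have degree at least `i + 2`. -/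
theorem IsMinimal.add_two_le_deg (hF : F.IsMinimal)
    (hI : ∀ p ∈ I, ∀ m ∈ p.support, 2 ≤ m.degree) (i : ℕ) (c : Fin (F.rank (i + 1))) :
    i + 2 ≤ F.deg (i + 1) c := by
  have hI₀ : ∀ p ∈ I, constantCoeff p = 0 := fun p hp => by
    by_contra h
    simpa using hI p hp 0 (mem_support_iff.2 h)
  have hne : ∀ i (c : Fin (F.rank (i + 1))), ∃ b m, m ∈ (F.d i (Pi.single c 1) b).support := by
    intro i c
    -- a basis vector killed by the differential would be a boundary with constant coordinate `1`
    by_contra! hall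
    have h0 : F.d i (Pi.single c 1) = 0 := by
      funext b
      exact support_eq_empty.1 (Finset.eq_empty_of_forall_notMem (hall b))
    have := hF.constantCoeff_of_d_eq_zero h0 c
    simp at this
  induction i with
  | zero =>
    obtain ⟨b₀, huniq, hdeg, hmem⟩ := hF.exists_zero hI₀
    obtain ⟨b, m, hm⟩ := hne 0 c
    have h₁ := F.d_homogeneous 0 c b m hm
    obtain rfl := huniq b
    have h₂ := hI _ ((hmem _).1 ⟨_, rfl⟩) m hm
    omega
  | succ i ih =>
    obtain ⟨b, m, hm⟩ := hne (i + 1) c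
    have h₁ := F.d_homogeneous (i + 1) c b m hm
    have h₂ := ih b
    have h₃ : m.degree ≠ 0 := by
      intro h
      rw [Finsupp.degree_eq_zero_iff] at h
      subst h
      exact mem_support_iff.1 hm (hF (i + 1) c b)
    omega

variable (F)

/-- The coefficient space of the part `R(-(n+2))^β` of `F_{n+1}`. -/
abbrev StrandSpace (n : ℕ) : Type _ := {b : Fin (F.rank (n + 1)) // F.deg (n + 1) b = n + 2} → K

/-- The embedding of `StrandSpace` into `F_{n+1}` as vectors of constants. -/
noncomputable def incl (n : ℕ) :
    F.StrandSpace n →ₗ[K] Fin (F.rank (n + 1)) → MvPolynomial V K :=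
  LinearMap.pi fun b => if h : F.deg (n + 1) b = n + 2 then
    Algebra.linearMap K (MvPolynomial V K) ∘ₗ LinearMap.proj ⟨b, h⟩ else 0

/-- The part of a vector in `F_{n+1}` with constant coordinates in degree `n + 2`. -/
noncomputable def strandPart (n : ℕ) (t : Fin (F.rank (n + 1)) → MvPolynomial V K) : F.StrandSpace n :=
  fun b => constantCoeff (t b)

/-- The coefficient of the variable `x_v` in the differential between the generators of degrees
`n + 3` and `n + 2`. -/
noncomputable def strandMatrix (n : ℕ) (v : V) : F.StrandSpace (n + 1) →ₗ[K] F.StrandSpace n :=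
  LinearMap.pi fun b => lcoeff K (Finsupp.single v 1) ∘ₗ LinearMap.proj b.1 ∘ₗ
    (F.d (n + 1)).restrictScalars K ∘ₗ F.incl (n + 1)

/-- The quadrics given by the generators of `F_1` of degree two, through their coefficients at pairs
of vertices of colours `true` and `false`. -/
noncomputable def strandBase (c : V → Bool) (b₀ : Fin (F.rank 0)) :
    F.StrandSpace 0 →ₗ[K] V → V → K :=
  LinearMap.pi fun a => LinearMap.pi fun b => if c a = true ∧ c b = false then
    lcoeff K (Finsupp.single a 1 + Finsupp.single b 1) ∘ₗ LinearMap.proj b₀ ∘ₗ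
      (F.d 0).restrictScalars K ∘ₗ F.incl 0 else 0

variable {F}

theorem incl_apply_of_eq {n : ℕ} (x : F.StrandSpace n) {b : Fin (F.rank (n + 1))}
    (h : F.deg (n + 1) b = n + 2) : F.incl n x b = C (x ⟨b, h⟩) := by
  simp [incl, h, MvPolynomial.algebraMap_eq]

theorem incl_apply_of_ne {n : ℕ} (x : F.StrandSpace n) {b : Fin (F.rank (n + 1))}
    (h : F.deg (n + 1) b ≠ n + 2) : F.incl n x b = 0 := by
  simp [incl, h]

theorem strandPart_incl {n : ℕ} (x : F.StrandSpace n) : F.strandPart n (F.incl n x) = x := by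
  funext b
  simp [strandPart, incl_apply_of_eq x b.2]

theorem strandMatrix_apply (n : ℕ) (v : V) (x : F.StrandSpace (n + 1))
    (b : {b : Fin (F.rank (n + 1)) // F.deg (n + 1) b = n + 2}) :
    F.strandMatrix n v x b = coeff (Finsupp.single v 1) (F.d (n + 1) (F.incl (n + 1) x) b) := rfl

theorem strandBase_apply (c : V → Bool) (b₀ : Fin (F.rank 0)) (x : F.StrandSpace 0) (a b : V) :
    F.strandBase c b₀ x a b = if c a = true ∧ c b = false then
      coeff (Finsupp.single a 1 + Finsupp.single b 1) (F.d 0 (F.incl 0 x) b₀) else 0 := by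
  simp only [strandBase, LinearMap.pi_apply]
  split_ifs <;> rfl

theorem isHomogeneousVector_incl {n : ℕ} (x : F.StrandSpace n) :
    IsHomogeneousVector (F.deg (n + 1)) (F.incl n x) (n + 2) := by
  classical
  intro b m hm
  by_cases h : F.deg (n + 1) b = n + 2
  · rw [incl_apply_of_eq x h] at hm
    have : m = 0 := by
      by_contra hne
      rw [mem_support_iff, coeff_C, if_neg (Ne.symm hne)] at hm
      exact hm rfl
    simp [this, h]
  · simp [incl_apply_of_ne x h] at hm

/-- The lowest coefficients of the differential only see the constant coordinates of lowest
degree. -/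
theorem coeff_d_eq_coeff_d_incl {n : ℕ} (t : Fin (F.rank (n + 1)) → MvPolynomial V K)
    (hdeg : ∀ c, n + 2 ≤ F.deg (n + 1) c) (b : Fin (F.rank n)) {m : V →₀ ℕ}
    (hm : m.degree + F.deg n b = n + 2) :
    coeff m (F.d n t b) = coeff m (F.d n (F.incl n (F.strandPart n t)) b) := by
  rw [linearMap_apply_eq_sum, linearMap_apply_eq_sum, coeff_sum, coeff_sum]
  refine Finset.sum_congr rfl fun c _ => ?_
  have hle : ∀ m' ∈ (F.d n (Pi.single c 1) b).support, m.degree ≤ m'.degree := fun m' hm' => by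
    have := F.d_homogeneous n c b m' hm'
    have := hdeg c
    omega
  rw [coeff_mul_of_degree_le hle, coeff_mul_of_degree_le hle]
  by_cases h : F.deg (n + 1) c = n + 2
  · rw [incl_apply_of_eq _ h, constantCoeff_C]
    rfl
  · rw [incl_apply_of_ne _ h]
    have : coeff m (F.d n (Pi.single c 1) b) = 0 := by
      by_contra hne
      have := F.d_homogeneous n c b m (mem_support_iff.2 hne)
      omega
    simp [this]

/-- Degrees and minimality force the differential of a generator of degree `n + 3` to be linear in the
generators of degree `n + 2`. -/
theorem IsMinimal.d_incl [Fintype V] (hF : F.IsMinimal)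
    (hI : ∀ p ∈ I, ∀ m ∈ p.support, 2 ≤ m.degree) (n : ℕ) (x : F.StrandSpace (n + 1)) :
    F.d (n + 1) (F.incl (n + 1) x) =
      ∑ v, (X v : MvPolynomial V K) • F.incl n (F.strandMatrix n v x) := by
  have hhom := (isHomogeneousVector_incl x).map (F.d_homogeneous (n + 1))
  funext b
  simp only [Finset.sum_apply, Pi.smul_apply, smul_eq_mul]
  have hb := hF.add_two_le_deg hI n b
  have h1 : ∀ m ∈ (F.d (n + 1) (F.incl (n + 1) x) b).support,
      m.degree = 1 ∧ F.deg (n + 1) b = n + 2 := by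
    intro m hm
    have := hhom b m hm
    have h₃ : m.degree ≠ 0 := by
      intro h
      rw [Finsupp.degree_eq_zero_iff] at h
      subst h
      exact mem_support_iff.1 hm (hF.constantCoeff_d (n + 1) _ b)
    omega
  by_cases h : F.deg (n + 1) b = n + 2
  · rw [eq_sum_of_degree_eq_one fun m hm => (h1 m hm).1]
    exact Finset.sum_congr rfl fun v _ => by rw [incl_apply_of_eq _ h]; rfl
  · have h0 : F.d (n + 1) (F.incl (n + 1) x) b = 0 :=
      support_eq_empty.1 (Finset.eq_empty_of_forall_notMem fun m hm => h (h1 m hm).2)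
    rw [h0]
    exact (Finset.sum_eq_zero fun v _ => by rw [incl_apply_of_ne _ h, mul_zero]).symm

theorem IsMinimal.eq_zero_of_d_incl (hF : F.IsMinimal) {n : ℕ} {x : F.StrandSpace n}
    (h : F.d n (F.incl n x) = 0) : x = 0 := by
  rw [← strandPart_incl x]
  funext b
  exact hF.constantCoeff_of_d_eq_zero h b

/-- A family of elements of the strand comes from the next term exactly if the vector with linear
coordinates that it defines is a cycle. -/
theorem IsMinimal.exists_strandMatrix_eq_iff [Fintype V] (hF : F.IsMinimal)
    (hI : ∀ p ∈ I, ∀ m ∈ p.support, 2 ≤ m.degree) (n : ℕ) (y : V → F.StrandSpace n) :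
    (∃ x, ∀ v, F.strandMatrix n v x = y v) ↔
      F.d n (∑ v, (X v : MvPolynomial V K) • F.incl n (y v)) = 0 := by
  classical
  rw [F.exact_succ n]
  constructor
  · rintro ⟨x, hx⟩
    refine ⟨F.incl (n + 1) x, ?_⟩
    rw [hF.d_incl hI]
    simp [hx]
  · rintro ⟨t, ht⟩
    refine ⟨F.strandPart (n + 1) t, fun v => ?_⟩
    funext b
    rw [strandMatrix_apply, ← coeff_d_eq_coeff_d_incl t (hF.add_two_le_deg hI (n + 1)) b.1
      (by rw [b.2, Finsupp.degree_single]; ring), ht]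
    simp [Finset.sum_apply, incl_apply_of_eq _ b.2, X_mul_C_eq_monomial, coeff_sum, coeff_monomial,
      Finsupp.single_left_inj]

theorem d_incl_zero_eq_quad [Fintype V] {H : SimpleGraph V} {c : V → Bool}
    (hc : ∀ u v, H.Adj u v → c u ≠ c v) {F : GradedFreeResolution (edgeIdeal K H)}
    {b₀ : Fin (F.rank 0)} (hdeg : F.deg 0 b₀ = 0)
    (hmem : ∀ x, (∃ t, F.d 0 t = x) ↔ x b₀ ∈ edgeIdeal K H) (x : F.StrandSpace 0) :
    F.d 0 (F.incl 0 x) b₀ = quad (F.strandBase c b₀ x) := by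
  have hI := (hmem _).1 ⟨F.incl 0 x, rfl⟩
  have h2 : ∀ m ∈ (F.d 0 (F.incl 0 x) b₀).support, m.degree = 2 := fun m hm => by
    have := (isHomogeneousVector_incl x).map (F.d_homogeneous 0) b₀ m hm
    omega
  refine (eq_quad_of_mem_edgeIdeal hc hI h2).trans ?_
  congr 1
  funext a b
  rw [strandBase_apply]

/-- Exactness of a minimal resolution of `R/I(H)` along its linear strand. -/
theorem IsMinimal.isLinearStrand [Fintype V] {H : SimpleGraph V} {c : V → Bool}
    (hc : ∀ u v, H.Adj u v → c u ≠ c v) {F : GradedFreeResolution (edgeIdeal K H)}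
    (hF : F.IsMinimal) {b₀ : Fin (F.rank 0)} (huniq : ∀ b, b = b₀) (hdeg : F.deg 0 b₀ = 0)
    (hmem : ∀ x, (∃ t, F.d 0 t = x) ↔ x b₀ ∈ edgeIdeal K H) :
    IsLinearStrand H c (F.strandBase c b₀) F.strandMatrix := by
  classical
  have hI : ∀ p ∈ edgeIdeal K H, ∀ m ∈ p.support, 2 ≤ m.degree :=
    fun p hp m hm => two_le_degree_of_mem_edgeIdeal hp hm
  have hbase := d_incl_zero_eq_quad (K := K) hc hdeg hmem
  have hzero : ∀ z : Fin (F.rank 0) → MvPolynomial V K, z = 0 ↔ z b₀ = 0 := fun z =>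
    ⟨fun h => by rw [h]; rfl, fun h => funext fun b => by rw [huniq b, h]; rfl⟩
  have hsupp : ∀ x a b, F.strandBase c b₀ x a b ≠ 0 → c a = true ∧ c b = false ∧ H.Adj a b := by
    intro x a b h
    rw [strandBase_apply] at h
    split_ifs at h with hab
    · exact ⟨hab.1, hab.2, adj_of_coeff_ne_zero_of_mem_edgeIdeal ((hmem _).1 ⟨_, rfl⟩) h⟩
    · exact absurd rfl h
  refine ⟨hsupp, fun g hg => ?_, fun x hx => ?_, fun n x hx => ?_, fun y => ?_, fun n y => ?_⟩
  · obtain ⟨t, ht⟩ := (hmem fun _ => quad g).2 (quad_mem_edgeIdeal fun a b h => (hg a b h).2.2)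
    refine ⟨F.strandPart 0 t, ?_⟩
    funext a b
    rw [strandBase_apply]
    split_ifs with hab
    · have hne : a ≠ b := by rintro rfl; simp [hab.1] at hab
      rw [← coeff_d_eq_coeff_d_incl t (hF.add_two_le_deg hI 0) b₀
        (by simp [hdeg, Finsupp.degree_single]), ht, coeff_quad, if_neg hne]
      have : g b a = 0 := by
        by_contra h
        simpa [hab.1] using (hg b a h).2.1
      rw [this, add_zero]
    · by_contra h
      exact hab ⟨(hg a b (Ne.symm h)).1, (hg a b (Ne.symm h)).2.1⟩
  · refine hF.eq_zero_of_d_incl ((hzero _).2 ?_)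
    rw [hbase, hx]
    simp [quad]
  · refine hF.eq_zero_of_d_incl ?_
    rw [hF.d_incl hI]
    simp [hx]
  · rw [hF.exists_strandMatrix_eq_iff hI, hzero,
      ← sum_X_mul_quad_eq_zero_iff fun v a b h => ⟨(hsupp _ a b h).1, (hsupp _ a b h).2.1⟩]
    simp [map_sum, Finset.sum_apply, hbase]
  · rw [hF.exists_strandMatrix_eq_iff hI]
    have hquad : ∀ b, F.d (n + 1) (∑ v, (X v : MvPolynomial V K) • F.incl (n + 1) (y v)) b.1 =
        quad fun v u => F.strandMatrix n u (y v) b := by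
      intro b
      simp [map_sum, hF.d_incl hI, Finset.sum_apply, incl_apply_of_eq _ b.2, quad]
    have hout : ∀ b, F.deg (n + 1) b ≠ n + 2 →
        F.d (n + 1) (∑ v, (X v : MvPolynomial V K) • F.incl (n + 1) (y v)) b = 0 := by
      intro b hb
      simp [map_sum, hF.d_incl hI, Finset.sum_apply, incl_apply_of_ne _ hb]
    constructor
    · intro h
      have h' := fun b => (quad_eq_zero_iff _).1 ((hquad b).symm.trans (congrFun h b.1))
      exact ⟨fun u v => funext fun b => (h' b).1 v u, fun v => funext fun b => (h' b).2 v⟩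
    · rintro ⟨h₁, h₂⟩
      funext b
      by_cases hb : F.deg (n + 1) b = n + 2
      · exact (hquad ⟨b, hb⟩).trans ((quad_eq_zero_iff _).2
          ⟨fun u v => congrFun (h₁ v u) ⟨b, hb⟩, fun v => congrFun (h₂ v) ⟨b, hb⟩⟩)
      · exact hout b hb

end GradedFreeResolution

/-! ### Existence of a minimal resolution -/

section Existence

variable {K : Type*} [Field K] {V : Type*}

/-- The homogeneous component of degree `n` of a vector in `⨁_b R(-deg b)`. -/
noncomputable def homogeneousPart {r : ℕ} (deg : Fin r → ℕ) (n : ℕ)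
    (x : Fin r → MvPolynomial V K) : Fin r → MvPolynomial V K :=
  fun b => if deg b ≤ n then homogeneousComponent (n - deg b) (x b) else 0

theorem coeff_homogeneousPart {r : ℕ} (deg : Fin r → ℕ) (n : ℕ) (x : Fin r → MvPolynomial V K)
    (b : Fin r) (m : V →₀ ℕ) : coeff m (homogeneousPart deg n x b) =
      if m.degree + deg b = n then coeff m (x b) else 0 := by
  rw [homogeneousPart]
  split_ifs with h₁ h₂ h₂
  · rw [coeff_homogeneousComponent, if_pos (by omega)]
  · rw [coeff_homogeneousComponent, if_neg (by omega)]
  · omega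
  · rfl

theorem isHomogeneousVector_homogeneousPart {r : ℕ} (deg : Fin r → ℕ) (n : ℕ)
    (x : Fin r → MvPolynomial V K) : IsHomogeneousVector deg (homogeneousPart deg n x) n := by
  intro b m hm
  by_contra h
  rw [mem_support_iff, coeff_homogeneousPart, if_neg h] at hm
  exact hm rfl

theorem exists_sum_homogeneousPart {r : ℕ} (deg : Fin r → ℕ) (x : Fin r → MvPolynomial V K) :
    ∃ B, ∑ n ∈ Finset.range B, homogeneousPart deg n x = x := by
  refine ⟨(∑ b, ((x b).totalDegree + deg b)) + 1, ?_⟩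
  funext b
  ext m
  simp only [Finset.sum_apply, coeff_sum, coeff_homogeneousPart]
  rw [Finset.sum_ite_eq, ite_eq_left_iff]
  intro h
  by_contra hne
  have h₁ : m.degree ≤ (x b).totalDegree := le_totalDegree (mem_support_iff.2 (Ne.symm hne))
  have h₂ := Finset.single_le_sum (f := fun b => (x b).totalDegree + deg b)
    (fun _ _ => Nat.zero_le _) (Finset.mem_univ b)
  simp only [Finset.mem_range] at h
  omega

/-- A homogeneous map of degree zero commutes with taking homogeneous components. -/
theorem homogeneousPart_map {r s : ℕ} {deg : Fin r → ℕ} {deg' : Fin s → ℕ}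
    {d : (Fin r → MvPolynomial V K) →ₗ[MvPolynomial V K] (Fin s → MvPolynomial V K)}
    (hd : ∀ c, IsHomogeneousVector deg' (d (Pi.single c 1)) (deg c)) (n : ℕ)
    (x : Fin r → MvPolynomial V K) :
    d (homogeneousPart deg n x) = homogeneousPart deg' n (d x) := by
  classical
  funext b
  ext m
  rw [coeff_homogeneousPart, linearMap_apply_eq_sum, linearMap_apply_eq_sum, coeff_sum, coeff_sum,
    Finset.ite_sum_zero]
  refine Finset.sum_congr rfl fun c _ => ?_
  rw [coeff_mul, coeff_mul, Finset.ite_sum_zero]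
  refine Finset.sum_congr rfl ?_
  rintro ⟨u, v⟩ huv
  rw [Finset.HasAntidiagonal.mem_antidiagonal] at huv
  dsimp only at huv ⊢
  rw [coeff_homogeneousPart]
  by_cases hv : coeff v (d (Pi.single c 1) b) = 0
  · simp [hv]
  have h₁ := hd c b v (mem_support_iff.2 hv)
  have h₂ : u.degree + v.degree = m.degree := by rw [← map_add, huv]
  have : u.degree + deg c = n ↔ m.degree + deg' b = n := by omega
  simp only [this, ite_mul, zero_mul]

/-- A submodule that contains the homogeneous components of its elements. -/
def IsGradedSubmodule {r : ℕ} (deg : Fin r → ℕ)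
    (N : Submodule (MvPolynomial V K) (Fin r → MvPolynomial V K)) : Prop :=
  ∀ x ∈ N, ∀ n, homogeneousPart deg n x ∈ N

theorem isGradedSubmodule_ker {r s : ℕ} {deg : Fin r → ℕ} {deg' : Fin s → ℕ}
    {d : (Fin r → MvPolynomial V K) →ₗ[MvPolynomial V K] (Fin s → MvPolynomial V K)}
    (hd : ∀ c, IsHomogeneousVector deg' (d (Pi.single c 1)) (deg c)) :
    IsGradedSubmodule deg (LinearMap.ker d) := by
  intro x hx n
  rw [LinearMap.mem_ker] at hx ⊢
  rw [homogeneousPart_map hd, hx]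
  funext b
  ext m
  simp [coeff_homogeneousPart]

theorem IsGradedSubmodule.exists_homogeneous_generators [Finite V] {s : ℕ} {deg : Fin s → ℕ}
    {N : Submodule (MvPolynomial V K) (Fin s → MvPolynomial V K)} (hN : IsGradedSubmodule deg N) :
    ∃ (r : ℕ) (deg' : Fin r → ℕ) (g : Fin r → Fin s → MvPolynomial V K),
      (∀ c, IsHomogeneousVector deg (g c) (deg' c)) ∧
      Submodule.span (MvPolynomial V K) (Set.range g) = N := by
  have hspan : Submodule.span (MvPolynomial V K) {y | y ∈ N ∧ ∃ n, IsHomogeneousVector deg y n}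
      = N := by
    refine le_antisymm (Submodule.span_le.2 fun y hy => hy.1) fun x hx => ?_
    obtain ⟨B, hB⟩ := exists_sum_homogeneousPart deg x
    rw [← hB]
    exact Submodule.sum_mem _ fun n _ => Submodule.subset_span
      ⟨hN x hx n, n, isHomogeneousVector_homogeneousPart deg n x⟩
  have hfg : N.FG := IsNoetherian.noetherian N
  rw [← hspan, Submodule.fg_span_iff_fg_span_finset_subset] at hfg
  obtain ⟨T, hT, hT'⟩ := hfg
  have hex : ∀ c : Fin T.card, ∃ n, IsHomogeneousVector deg (T.equivFin.symm c).1 n :=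
    fun c => (hT (T.equivFin.symm c).2).2
  choose deg' hdeg' using hex
  refine ⟨T.card, deg', fun c => (T.equivFin.symm c).1, hdeg', ?_⟩
  have hr : Set.range (fun c => (T.equivFin.symm c).1) = (T : Set (Fin s → MvPolynomial V K)) := by
    ext y
    constructor
    · rintro ⟨c, rfl⟩
      exact (T.equivFin.symm c).2
    · intro hy
      exact ⟨T.equivFin ⟨y, hy⟩, by simp⟩
  rw [hr, ← hT', hspan]

/-- Homogeneous generators, as few as possible, give a cover whose kernel has no constant
coordinate: otherwise one generator would be a combination of the others. -/
theorem IsGradedSubmodule.exists_minimal_cover [Finite V] {s : ℕ} {deg : Fin s → ℕ}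
    {N : Submodule (MvPolynomial V K) (Fin s → MvPolynomial V K)} (hN : IsGradedSubmodule deg N) :
    ∃ (r : ℕ) (deg' : Fin r → ℕ)
      (d : (Fin r → MvPolynomial V K) →ₗ[MvPolynomial V K] (Fin s → MvPolynomial V K)),
      (∀ c, IsHomogeneousVector deg (d (Pi.single c 1)) (deg' c)) ∧ LinearMap.range d = N ∧
      ∀ x, d x = 0 → ∀ c, constantCoeff (x c) = 0 := by
  classical
  have hex := hN.exists_homogeneous_generators
  obtain ⟨deg', g, hg, hspan⟩ := Nat.find_spec hex
  have hmin := fun r => Nat.find_min hex (m := r)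
  generalize Nat.find hex = r at deg' g hg hspan hmin
  let d := Fintype.linearCombination (MvPolynomial V K) g
  have hd : ∀ c, d (Pi.single c 1) = g c := fun c => by
    simp [d, Fintype.linearCombination_apply_single]
  have hdh : ∀ c, IsHomogeneousVector deg (d (Pi.single c 1)) (deg' c) := fun c => by
    rw [hd]; exact hg c
  refine ⟨r, deg', d, hdh, ?_, fun x hx c => ?_⟩
  · rw [← hspan, Fintype.range_linearCombination]
  by_contra hc
  cases r with
  | zero => exact c.elim0
  | succ r =>
    refine hmin r (Nat.lt_succ_self r) ⟨fun i => deg' (c.succAbove i), fun i => g (c.succAbove i),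
      fun i => hg _, ?_⟩
    rw [← hspan]
    refine le_antisymm (Submodule.span_mono (by rintro _ ⟨i, rfl⟩; exact ⟨_, rfl⟩)) ?_
    rw [Submodule.span_le]
    rintro _ ⟨j, rfl⟩
    have hj : ∀ i, g (c.succAbove i) ∈
        Submodule.span (MvPolynomial V K) (Set.range fun i => g (c.succAbove i)) :=
      fun i => Submodule.subset_span ⟨i, rfl⟩
    rcases Fin.eq_self_or_eq_succAbove c j with rfl | ⟨i, rfl⟩
    swap
    · exact hj i
    -- the component of the relation in the degree of `g j` has a nonzero constant at `j`
    have h0 : d (homogeneousPart deg' (deg' j) x) = 0 := by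
      rw [homogeneousPart_map hdh, hx]
      funext b
      ext m
      simp [coeff_homogeneousPart]
    have hCj : homogeneousPart deg' (deg' j) x j = C (constantCoeff (x j)) := by
      simp [homogeneousPart, homogeneousComponent_zero, constantCoeff_eq]
    rw [linearMap_eq_sum_smul, Fin.sum_univ_succAbove _ j, hCj, hd] at h0
    have hmem : (C (constantCoeff (x j)) : MvPolynomial V K) • g j ∈
        Submodule.span (MvPolynomial V K) (Set.range fun i => g (j.succAbove i)) := by
      rw [eq_neg_of_add_eq_zero_left h0]
      refine Submodule.neg_mem _ (Submodule.sum_mem _ fun i _ => Submodule.smul_mem _ _ ?_)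
      rw [hd]
      exact hj i
    have := Submodule.smul_mem _ (C (constantCoeff (x j))⁻¹ : MvPolynomial V K) hmem
    rwa [smul_smul, ← C_mul, inv_mul_cancel₀ hc, C_1, one_smul] at this

/-- A graded submodule of a graded free module of finite rank: the module of cycles to be covered at
one step of the construction of a resolution. -/
structure GradedCycles (K : Type*) [Field K] (V : Type*) where
  /-- The rank of the ambient free module. -/
  rank : ℕ
  /-- The degrees of its basis elements. -/
  deg : Fin rank → ℕ
  /-- The submodule. -/
  cycles : Submodule (MvPolynomial V K) (Fin rank → MvPolynomial V K)
  graded : IsGradedSubmodule deg cycles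

namespace GradedCycles

variable [Finite V] (S : GradedCycles K V)

/-- The kernel of a minimal cover of the given cycles. -/
noncomputable def next : GradedCycles K V where
  rank := S.graded.exists_minimal_cover.choose
  deg := S.graded.exists_minimal_cover.choose_spec.choose
  cycles := LinearMap.ker S.graded.exists_minimal_cover.choose_spec.choose_spec.choose
  graded := isGradedSubmodule_ker
    S.graded.exists_minimal_cover.choose_spec.choose_spec.choose_spec.1

/-- A minimal cover of the given cycles. -/
noncomputable def cover : (Fin S.next.rank → MvPolynomial V K) →ₗ[MvPolynomial V K]
    (Fin S.rank → MvPolynomial V K) :=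
  S.graded.exists_minimal_cover.choose_spec.choose_spec.choose

theorem cover_homogeneous (c : Fin S.next.rank) :
    IsHomogeneousVector S.deg (S.cover (Pi.single c 1)) (S.next.deg c) :=
  S.graded.exists_minimal_cover.choose_spec.choose_spec.choose_spec.1 c

theorem range_cover : LinearMap.range S.cover = S.cycles :=
  S.graded.exists_minimal_cover.choose_spec.choose_spec.choose_spec.2.1

theorem constantCoeff_of_mem_cycles_next {x : Fin S.next.rank → MvPolynomial V K}
    (hx : x ∈ S.next.cycles) (c : Fin S.next.rank) : constantCoeff (x c) = 0 :=
  S.graded.exists_minimal_cover.choose_spec.choose_spec.choose_spec.2.2 x hx c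

/-- The iterated syzygies of the given cycles. -/
noncomputable def syzygy : ℕ → GradedCycles K V
  | 0 => S
  | i + 1 => (syzygy i).next

end GradedCycles

/-- Iterated minimal covers of the syzygies form a minimal graded free resolution. -/
theorem exists_isMinimal_gradedFreeResolution [Finite V] {I : Ideal (MvPolynomial V K)}
    (hI : ∀ p ∈ I, constantCoeff p = 0)
    (hgr : ∀ p ∈ I, ∀ n, homogeneousComponent n p ∈ I) :
    ∃ F : GradedFreeResolution I, F.IsMinimal := by
  let S₀ : GradedCycles K V :=
    { rank := 1
      deg := fun _ => 0
      cycles := Submodule.comap (LinearMap.proj 0) I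
      graded := fun x hx n => by simpa [homogeneousPart] using hgr _ hx n }
  let F : GradedFreeResolution I :=
    { rank := fun i => (S₀.syzygy i).rank
      deg := fun i => (S₀.syzygy i).deg
      d := fun i => (S₀.syzygy i).cover
      aug := I.mkQ ∘ₗ (LinearMap.proj (0 : Fin 1) :
        (Fin 1 → MvPolynomial V K) →ₗ[MvPolynomial V K] MvPolynomial V K)
      d_homogeneous := fun i c => (S₀.syzygy i).cover_homogeneous c
      aug_homogeneous := fun b => ⟨1, isHomogeneous_one V K, by
        change Ideal.Quotient.mk I ((Pi.single b 1 : Fin 1 → MvPolynomial V K) 0) = _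
        have hb : b = (0 : Fin 1) := Subsingleton.elim (α := Fin 1) _ _
        rw [hb, Pi.single_eq_same]⟩
      aug_surjective := fun q => by
        obtain ⟨p, rfl⟩ := I.mkQ_surjective q
        exact ⟨fun _ => p, rfl⟩
      exact_zero := fun x => by
        refine Iff.trans ?_ (SetLike.ext_iff.1 S₀.range_cover.symm x)
        exact Submodule.Quotient.mk_eq_zero I
      exact_succ := fun i x => SetLike.ext_iff.1 (S₀.syzygy (i + 1)).range_cover.symm x }
  refine ⟨F, fun i c b => ?_⟩
  have hmem : F.d i (Pi.single c 1) ∈ (S₀.syzygy i).cycles := by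
    rw [← GradedCycles.range_cover]
    exact ⟨_, rfl⟩
  cases i with
  | zero =>
    have hb : b = (0 : Fin 1) := Subsingleton.elim (α := Fin 1) _ _
    rw [hb]
    exact hI _ hmem
  | succ i => exact (S₀.syzygy i).constantCoeff_of_mem_cycles_next hmem b

end Existence

/-! ### The Betti numbers -/

theorem corollary2p2 (K : Type*) [Field K] {V : Type*} [Fintype V]
    (H : SimpleGraph V) (hH : H.IsBipartite) (i : ℕ) :
    IsGradedBettiNumber (edgeIdeal K H) i (i + 1)
      {S : Finset V | S.card = i + 1 ∧
        Nat.card (Hᶜ.induce (S : Set V)).ConnectedComponent = 2}.ncard := by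
  obtain ⟨color⟩ := hH
  let c : V → Bool := fun v => decide (color v = 0)
  have hc : ∀ u v, H.Adj u v → c u ≠ c v := by
    intro u v h heq
    have h₁ : color u ≠ color v := color.valid h
    have h₂ : color u = 0 ↔ color v = 0 := by simpa [c] using heq
    omega
  have hI : ∀ p ∈ edgeIdeal K H, constantCoeff p = 0 :=
    fun p hp => constantCoeff_of_mem_edgeIdeal hp
  refine ⟨exists_isMinimal_gradedFreeResolution hI fun p hp n => ?_, fun F hF => ?_⟩
  · rw [mem_edgeIdeal_iff] at hp ⊢
    intro m hm
    refine hp m (mem_support_iff.2 fun h => ?_)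
    rw [mem_support_iff, coeff_homogeneousComponent, h, ite_self] at hm
    exact hm rfl
  have hset : {S : Finset V | S.card = i + 1 ∧
      Nat.card (Hᶜ.induce (S : Set V)).ConnectedComponent = 2} =
      {S | IsBiclique H c (i + 1) S} := by
    ext S
    simp only [Set.mem_ofPred_eq, natCard_connectedComponent_compl_induce_eq_two_iff hc]
    constructor
    · rintro ⟨h, hS⟩
      rwa [h] at hS
    · intro hS
      exact ⟨hS.1, by rwa [hS.1]⟩
  rw [hset]
  obtain ⟨b₀, huniq, hdeg, hmem⟩ := hF.exists_zero hI
  cases i with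
  | zero =>
    -- `F_0 = R` has no generator of degree one, and a single vertex has only one colour
    have hempty : {S : Finset V | IsBiclique H c (0 + 1) S} = ∅ := by
      refine Set.eq_empty_of_forall_notMem fun S hS => ?_
      obtain ⟨hcard, ⟨a, ha, hca⟩, ⟨b, hb, hcb⟩, -⟩ := hS
      obtain rfl := Finset.card_le_one.1 hcard.le a ha b hb
      rw [hca] at hcb
      exact Bool.noConfusion hcb
    rw [hempty, Set.ncard_empty, GradedFreeResolution.numSummands, Finset.card_eq_zero,
      Finset.filter_eq_empty_iff]
    intro b _
    rw [huniq b, hdeg]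
    simp
  | succ n =>
    rw [← (hF.isLinearStrand hc huniq hdeg hmem).finrank_eq n, Module.finrank_fintype_fun_eq_card,
      Fintype.card_subtype]
    rfl
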